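/- **Model.** A network is a finite connected simple graph $G=(V,E)$ with $n=|V|$ vertices. The vertices carry pairwise distinct identifiers in $\{0,\dots,n^{a}-1\}$ for a constant $a$, and every vertex $v$ numbers its incident edges arbitrarily by ports $0,\dots,\deg(v)-1$. In a deterministic CONGEST algorithm with parameter $k$ all vertices run the same deterministic program. At the start a vertex knows only $k$, its own identifier and its degree (in particular, it need not know $n$ or the identifiers of its neighbours). Computation proceeds in synchronous rounds: in each round every vertex may send a (possibly different) message of $O(\log n)$ bits to each of its neighbours, receives the messages sent to it, and updates its state by unrestricted local computation. At some point a vertex terminates by irrevocably fixing its output, after which it sends nothing. The running time is the number of communication rounds until all vertices have terminated. **Problem $k$-MVC.** If $G$ has a vertex cover of size at most $k$, then every vertex must output whether it belongs to the solution, and the vertices that say they do must form a vertex cover of $G$ of size at most $k$. If $G$ has no vertex cover of size at most $k$, then every vertex must report that no solution exists. **Theorem.** There is a deterministic CONGEST algorithm that solves $k$-MVC in $O(k^2)$ rounds. Precisely: there are one deterministic algorithm and an absolute constant $C$, and for every $a\in\mathbb N$ a constant $b$, such that for every network with $n$ vertices and identifiers less than $n^{a}$, for every port numbering, and for every integer $k\ge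 0$, all messages have at most $b\lfloor\log_2 n\rfloor$ bits, all vertices terminate within $Ck^2$ communication rounds, and their outputs solve $k$-MVC on $G$. -/

import Mathlib

/-- A communication network on the vertex set `V`: a connected simple graph, pairwise distinct
numerical identifiers, and at every vertex a numbering of its incident edges by the ports
`0, …, deg v - 1`. The equivalence `port v` forces `deg v` to be the degree of `v`. The port
numbering is arbitrary and bears no relation to the identifiers. -/
structure CongestNetwork (V : Type*) where
  graph : SimpleGraph V
  connected : graph.Connected
  ident : V → ℕ
  ident_injective : Function.Injective ident
  deg : V → ℕ
  port : ∀ v, Fin (deg v) ≃ graph.neighborSet v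

namespace CongestNetwork

variable {V : Type*} (N : CongestNetwork V)

/-- The neighbour of `v` at the other end of port `p`. -/
def neighbor (v : V) (p : Fin (N.deg v)) : V := (N.port v p : V)

/-- The port through which the neighbour at port `p` of `v` is in turn connected to `v`. -/
def backPort (v : V) (p : Fin (N.deg v)) : Fin (N.deg (N.neighbor v p)) :=
  (N.port (N.neighbor v p)).symm
    ⟨v, (N.graph.mem_neighborSet _ _).2
      ((N.graph.mem_neighborSet _ _).1 (N.port v p).2).symm⟩

end CongestNetwork

/-- What a vertex reports in the parameterized vertex cover problem. -/
inductive CoverAnswer where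
  | inCover
  | notInCover
  | noSolution

/-- A deterministic synchronous message-passing algorithm with an integer parameter `k`, run by
every vertex. Local computation is unrestricted. Initially a vertex knows only the parameter, its
own identifier and its degree. Messages are bit strings, the empty one being silence. `output` is
`none` as long as the vertex is running. -/
structure DistributedAlgorithm where
  State : Type
  init : (k ident deg : ℕ) → State
  send : (deg : ℕ) → State → Fin deg → List Bool
  receive : (deg : ℕ) → State → (Fin deg → List Bool) → State
  output : State → Option CoverAnswer

namespace DistributedAlgorithm

variable (A : DistributedAlgorithm) {V : Type*} (N : CongestNetwork V)

/-- The message that a vertex of degree `d` in state `s` sends through port `p` in the next round.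
A vertex that has produced its output has terminated and stays silent. -/
def message (d : ℕ) (s : A.State) (p : Fin d) : List Bool :=
  if (A.output s).isSome then [] else A.send d s p

/-- The state of `v` after `t` communication rounds. A vertex that has produced its output has
terminated and never changes its state again. -/
def state (k : ℕ) : ℕ → V → A.State
  | 0, v => A.init k (N.ident v) (N.deg v)
  | t + 1, v =>
    if (A.output (state k t v)).isSome then state k t v
    else A.receive (N.deg v) (state k t v) fun p =>
      A.message (N.deg (N.neighbor v p)) (state k t (N.neighbor v p)) (N.backPort v p)

/-- In the run with parameter `k`, no message ever exceeds `b` bits. -/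
def MessagesBounded (k b : ℕ) : Prop :=
  ∀ (t : ℕ) (v : V) (p : Fin (N.deg v)), (A.message (N.deg v) (A.state N k t v) p).length ≤ b

/-- In the run with parameter `k`, every vertex `v` has terminated with output `o v` after at
most `T` communication rounds. -/
def TerminatesWithin (k T : ℕ) (o : V → CoverAnswer) : Prop :=
  ∀ v, ∃ t ≤ T, A.output (A.state N k t v) = some (o v)

end DistributedAlgorithm

/-- The reports `o` of the vertices solve the vertex cover problem on `G` with parameter `k`:
if `G` has a vertex cover of size at most `k`, then every vertex reports whether it is in the
solution, and those that report that they are form a vertex cover of size at most `k`;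
otherwise every vertex reports that there is no solution. -/
def SolvesKMVC {V : Type*} (G : SimpleGraph V) (k : ℕ) (o : V → CoverAnswer) : Prop :=
  ((∃ S : Finset V, G.IsVertexCover (S : Set V) ∧ S.card ≤ k) →
    (∀ v, o v ≠ CoverAnswer.noSolution) ∧
      ∃ S : Finset V, (∀ v, v ∈ S ↔ o v = CoverAnswer.inCover) ∧
        G.IsVertexCover (S : Set V) ∧ S.card ≤ k) ∧
  ((¬ ∃ S : Finset V, G.IsVertexCover (S : Set V) ∧ S.card ≤ k) →
    ∀ v, o v = CoverAnswer.noSolution)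

/-! A vertex of degree above `k` lies in every cover of size at most `k`, so it suffices to record
loops at such vertices and edges between the others. If a small cover exists, each of its vertices
accounts for at most `2 * k + 1` of these items, so there are at most `k * (2 * k + 1)`
(`ncard_items_le`). Each vertex forwards one item per round, and pipelining (`le_ncard_known`) shows
that after `t` rounds a vertex knows at least `t - d` items or everything from within distance `d`.
For `t = 7 * k ^ 2` and `d = 2 * k + 1` it has seen too many items for a small cover to exist, or it
knows its whole ball of radius `d` (`known_final`).

In the latter case, if `k` identifiers hit all known items, then the ball is the whole network,
because a longer path would contain `k + 1` disjoint edges to be hit (`exists_walk_length_le`). So a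
positive answer certifies a global cover. If a small cover exists, all vertices end with the same
set of items and hence choose the same solution without further communication. -/

/-! ### Encoding of items as short messages -/

/-- The bit string that stands for the pair `(x, y)`. -/
def pairCode (x y : ℕ) : List Bool := (Nat.pair x y + 1).bits

theorem pairCode_inj {x y x' y' : ℕ} (h : pairCode x y = pairCode x' y') : x = x' ∧ y = y' := by
  have h1 : Nat.pair x y + 1 = Nat.pair x' y' + 1 := by
    apply Nat.digits.injective 2
    rw [Nat.digits_two_eq_bits, Nat.digits_two_eq_bits]
    exact congrArg _ h
  exact Nat.pair_eq_pair.1 (Nat.succ_injective h1)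

/-- The `+ 1` in the code keeps the pair `(0, 0)` distinct from silence. -/
theorem pairCode_ne_nil (x y : ℕ) : pairCode x y ≠ [] := by
  intro h
  have := congrArg List.length h
  rw [pairCode, Nat.size_eq_bits_len, List.length_nil, Nat.size_eq_zero] at this
  omega

theorem length_pairCode_le {x y n a : ℕ} (hn : 2 ≤ n) (hx : x < n ^ a) (hy : y < n ^ a) :
    (pairCode x y).length ≤ (4 * a + 1) * Nat.log 2 n := by
  have hlog : 1 ≤ Nat.log 2 n := Nat.log_pos (by norm_num) hn
  have h1 : Nat.pair x y + 1 ≤ (n ^ a) ^ 2 :=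
    (Nat.pair_lt_max_add_one_sq x y).trans_le (Nat.pow_le_pow_left (max_lt hx hy) 2)
  have h2 : n ≤ 2 ^ (Nat.log 2 n + 1) := (Nat.lt_pow_succ_log_self (by norm_num) n).le
  have h3 : (n ^ a) ^ 2 ≤ 2 ^ ((Nat.log 2 n + 1) * a * 2) := by
    rw [pow_mul, pow_mul]
    gcongr
  -- The rounding term `2 * a` is absorbed since the logarithm is at least `1`; the extra `1` in `4
  -- * a + 1` makes the inequality strict.
  have h4 : (Nat.log 2 n + 1) * a * 2 < (4 * a + 1) * Nat.log 2 n := by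
    nlinarith [Nat.mul_le_mul_right a hlog]
  rw [pairCode, Nat.size_eq_bits_len, Nat.size_le]
  exact (h1.trans h3).trans_lt (Nat.pow_lt_pow_right (by norm_num) h4)

/-! ### The flooding algorithm -/

/-- `R` contains an entry of every pair whose code is in `K`. -/
def Hits (R : Finset ℕ) (K : Set (List Bool)) : Prop :=
  ∀ x y, pairCode x y ∈ K → x ∈ R ∨ y ∈ R

open Classical in
/-- An unsent known item, or silence if there is none. -/
noncomputable def nextItem (known sent : Set (List Bool)) : List Bool :=
  if h : (known \ sent).Nonempty then h.some else []

open Classical in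
/-- The report of the vertex with identifier `x` that knows the items `K`. -/
noncomputable def coverReport (k x : ℕ) (K : Set (List Bool)) : CoverAnswer :=
  if h : K.ncard ≤ k * (2 * k + 1) ∧ ∃ R : Finset ℕ, R.card ≤ k ∧ Hits R K then
    if x ∈ h.2.choose then .inCover else .notInCover
  else .noSolution

structure FloodState where
  param : ℕ
  ident : ℕ
  time : ℕ
  known : Set (List Bool)
  sent : Set (List Bool)

open Classical in
/-- In the first round the vertices of degree at most `k` announce their identifiers. The items are
the loops at the vertices of degree above `k` and the edges between the other vertices. Then every
vertex forwards one unsent item per round, until after `7 * k ^ 2` rounds it answers for the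
instance that consists of all items known to it. -/
noncomputable def coverFlooding : DistributedAlgorithm where
  State := FloodState
  init k x d := ⟨k, x, 0, {m | k < d ∧ m = pairCode x x}, ∅⟩
  send d s _ :=
    if s.time = 0 then (if d ≤ s.param then pairCode s.ident s.ident else [])
    else nextItem s.known s.sent
  receive d s msg :=
    if s.time = 0 then
      { s with
        time := 1
        known := s.known ∪
          {m | d ≤ s.param ∧ ∃ p y, msg p = pairCode y y ∧ m = pairCode s.ident y} }
    else
      { s with
        time := s.time + 1
        known := s.known ∪ (Set.range msg \ {[]})
        sent := s.sent ∪ ({nextItem s.known s.sent} \ {[]}) }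
  output s :=
    if 7 * s.param ^ 2 ≤ s.time then some (coverReport s.param s.ident s.known) else none

theorem nextItem_mem {K S : Set (List Bool)} (h : nextItem K S ≠ []) : nextItem K S ∈ K \ S := by
  unfold nextItem at h ⊢
  split_ifs at h ⊢ with h'
  · exact h'.some_mem
  · exact absurd rfl h

theorem nextItem_mem_of_nonempty {K S : Set (List Bool)} (h : (K \ S).Nonempty) :
    nextItem K S ∈ K \ S := by
  unfold nextItem
  rw [dif_pos h]
  exact h.some_mem

/-! ### Combinatorics of items and small covers -/

namespace CongestNetwork

variable {V : Type*} (N : CongestNetwork V)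

theorem neighbor_adj (v : V) (p : Fin (N.deg v)) : N.graph.Adj v (N.neighbor v p) :=
  (N.graph.mem_neighborSet _ _).1 (N.port v p).2

theorem exists_neighbor {v w : V} (h : N.graph.Adj v w) : ∃ p, N.neighbor v p = w :=
  ⟨(N.port v).symm ⟨w, h⟩, by simp [neighbor]⟩

/-- The items that originate at `v`. -/
def ownItems (k : ℕ) (v : V) : Set (List Bool) :=
  {m | (k < N.deg v ∧ m = pairCode (N.ident v) (N.ident v)) ∨
    (N.deg v ≤ k ∧ ∃ w, N.graph.Adj v w ∧ N.deg w ≤ k ∧ m = pairCode (N.ident v) (N.ident w))}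

/-- All items of the network. -/
def items (k : ℕ) : Set (List Bool) := ⋃ v, N.ownItems k v

theorem ownItems_subset_items (k : ℕ) (v : V) : N.ownItems k v ⊆ N.items k :=
  Set.subset_iUnion _ v

theorem exists_eq_of_mem_items {k : ℕ} {m : List Bool} (h : m ∈ N.items k) :
    ∃ v w, m = pairCode (N.ident v) (N.ident w) := by
  obtain ⟨v, hv⟩ := Set.mem_iUnion.1 h
  rcases hv with ⟨-, h⟩ | ⟨-, w, -, -, h⟩
  exacts [⟨v, v, h⟩, ⟨v, w, h⟩]

theorem ne_nil_of_mem_items {k : ℕ} {m : List Bool} (h : m ∈ N.items k) : m ≠ [] := by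
  obtain ⟨v, w, rfl⟩ := N.exists_eq_of_mem_items h
  exact pairCode_ne_nil _ _

theorem finite_items [Finite V] (k : ℕ) : (N.items k).Finite := by
  refine (Set.finite_range fun p : V × V => pairCode (N.ident p.1) (N.ident p.2)).subset ?_
  intro m hm
  obtain ⟨v, w, rfl⟩ := N.exists_eq_of_mem_items hm
  exact ⟨(v, w), rfl⟩

/-- `K` contains all items that originate within distance `d` of `v`. -/
def KnowsBall (k d : ℕ) (v : V) (K : Set (List Bool)) : Prop :=
  ∀ (u : V) (q : N.graph.Walk v u), q.length ≤ d → N.ownItems k u ⊆ K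

theorem KnowsBall.mono {N : CongestNetwork V} {k d : ℕ} {v : V} {K K' : Set (List Bool)}
    (h : N.KnowsBall k d v K) (hK : K ⊆ K') : N.KnowsBall k d v K' :=
  fun u q hq => (h u q hq).trans hK

/-- Otherwise all of its more than `k` neighbours would have to lie in the cover. -/
theorem mem_of_lt_deg [Fintype V] {k : ℕ} {S : Finset V} (hS : N.graph.IsVertexCover (S : Set V))
    (hk : S.card ≤ k) {v : V} (hv : k < N.deg v) : v ∈ S := by
  by_contra hvS
  have h1 : ∀ p, N.neighbor v p ∈ S := fun p =>
    (hS (N.neighbor_adj v p)).resolve_left hvS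
  have h2 : Function.Injective (N.neighbor v) :=
    Subtype.val_injective.comp (N.port v).injective
  have h3 := Finset.card_le_card_of_injOn (s := Finset.univ) (t := S) (N.neighbor v)
    (fun p _ => h1 p) h2.injOn
  simp at h3
  omega

theorem hits_items [Fintype V] {k : ℕ} {S : Finset V}
    (hS : N.graph.IsVertexCover (S : Set V)) (hk : S.card ≤ k) :
    Hits (S.image N.ident) (N.items k) := by
  intro x y h
  obtain ⟨v, hv⟩ := Set.mem_iUnion.1 h
  rcases hv with ⟨hd, h⟩ | ⟨-, w, hvw, -, h⟩ <;> obtain ⟨rfl, rfl⟩ := pairCode_inj h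
  · exact Or.inl (Finset.mem_image_of_mem _ (N.mem_of_lt_deg hS hk hd))
  · exact (hS hvw).imp (Finset.mem_image_of_mem _) (Finset.mem_image_of_mem _)

open Classical in
-- Each item is charged to a cover vertex on it: a vertex of high degree pays for its loop, any
-- other for both orientations of its at most `k` edges.
theorem ncard_items_le [Fintype V] {k : ℕ} {S : Finset V}
    (hS : N.graph.IsVertexCover (S : Set V)) (hk : S.card ≤ k) :
    (N.items k).ncard ≤ k * (2 * k + 1) := by
  let F : V → Finset (List Bool) := fun s =>
    if k < N.deg s then {pairCode (N.ident s) (N.ident s)} else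
      Finset.univ.image (fun p => pairCode (N.ident s) (N.ident (N.neighbor s p))) ∪
      Finset.univ.image (fun p => pairCode (N.ident (N.neighbor s p)) (N.ident s))
  have hF : ∀ s, (F s).card ≤ 2 * k + 1 := by
    intro s
    simp only [F]
    split_ifs with h
    · simp
    · refine (Finset.card_union_le _ _).trans ?_
      have h1 := Finset.card_image_le (s := Finset.univ)
        (f := fun p => pairCode (N.ident s) (N.ident (N.neighbor s p)))
      have h2 := Finset.card_image_le (s := Finset.univ)
        (f := fun p => pairCode (N.ident (N.neighbor s p)) (N.ident s))
      simp only [Finset.card_univ, Fintype.card_fin] at h1 h2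
      omega
  have hsub : N.items k ⊆ (S.biUnion F : Finset (List Bool)) := by
    intro m hm
    obtain ⟨v, hv⟩ := Set.mem_iUnion.1 hm
    rw [Finset.mem_coe, Finset.mem_biUnion]
    rcases hv with ⟨hd, rfl⟩ | ⟨hd, w, hvw, hw, rfl⟩
    · exact ⟨v, N.mem_of_lt_deg hS hk hd, by simp [F, hd]⟩
    · rcases hS hvw with h | h
      · obtain ⟨p, rfl⟩ := N.exists_neighbor hvw
        refine ⟨v, h, ?_⟩
        simp only [F, if_neg (not_lt.2 hd)]
        exact Finset.mem_union_left _ (Finset.mem_image.2 ⟨p, Finset.mem_univ _, rfl⟩)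
      · obtain ⟨p, rfl⟩ := N.exists_neighbor hvw.symm
        refine ⟨w, h, ?_⟩
        simp only [F, if_neg (not_lt.2 hw)]
        exact Finset.mem_union_right _ (Finset.mem_image.2 ⟨p, Finset.mem_univ _, rfl⟩)
  calc (N.items k).ncard ≤ ((S.biUnion F : Finset (List Bool)) : Set (List Bool)).ncard :=
        Set.ncard_le_ncard hsub (Finset.finite_toSet _)
    _ = (S.biUnion F).card := Set.ncard_coe_finset _
    _ ≤ S.card * (2 * k + 1) := Finset.card_biUnion_le_card_mul _ _ _ fun s _ => hF s
    _ ≤ k * (2 * k + 1) := Nat.mul_le_mul_right _ hk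

/-- An edge with an endpoint of high degree is not an item, but the loop there forces that endpoint
into `R`. -/
theorem hits_edge {k : ℕ} {R : Finset ℕ} {K : Set (List Bool)} (hR : Hits R K) {u w : V}
    (huw : N.graph.Adj u w) (hu : N.ownItems k u ⊆ K) (hw : N.ownItems k w ⊆ K) :
    N.ident u ∈ R ∨ N.ident w ∈ R := by
  by_cases h1 : N.deg u ≤ k
  · by_cases h2 : N.deg w ≤ k
    · exact hR _ _ (hu (Or.inr ⟨h1, w, huw, h2, rfl⟩))
    · exact Or.inr (or_self_iff.1 (hR _ _ (hw (Or.inl ⟨not_le.1 h2, rfl⟩))))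
  · exact Or.inl (or_self_iff.1 (hR _ _ (hu (Or.inl ⟨not_le.1 h1, rfl⟩))))

/-- A small solution of all constraints within distance `2 * k + 1` bounds the eccentricity. -/
theorem exists_walk_length_le {k : ℕ} {v : V} {R : Finset ℕ} {K : Set (List Bool)}
    (hk : R.card ≤ k) (hR : Hits R K) (hK : N.KnowsBall k (2 * k + 1) v K) (u : V) :
    ∃ q : N.graph.Walk v u, q.length ≤ 2 * k + 1 := by
  obtain ⟨q, hq, -⟩ := N.connected.exists_path_of_dist v u
  refine ⟨q, ?_⟩
  by_contra! hlen
  have hball : ∀ i ≤ 2 * k + 1, N.ownItems k (q.getVert i) ⊆ K := fun i hi =>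
    hK _ (q.take i) ((SimpleGraph.Walk.take_length _ _).trans_le (by omega))
  -- The `k + 1` edges from position `2 * i` to `2 * i + 1` of the path are disjoint and lie within
  -- the ball, so they demand `k + 1` distinct members of `R`. Beyond `i = k` the value of `j` is
  -- irrelevant.
  have hcov : ∀ i : ℕ, ∃ j, i < k + 1 → (j = 2 * i ∨ j = 2 * i + 1) ∧ N.ident (q.getVert j) ∈ R := by
    intro i
    by_cases hi : i < k + 1
    · rcases N.hits_edge hR (q.adj_getVert_succ (i := 2 * i) (by omega)) (hball _ (by omega))
        (hball _ (by omega)) with h | h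
      exacts [⟨_, fun _ => ⟨Or.inl rfl, h⟩⟩, ⟨_, fun _ => ⟨Or.inr rfl, h⟩⟩]
    · exact ⟨0, fun h => absurd h hi⟩
  choose j hj using hcov
  have h := Finset.card_le_card_of_injOn (s := Finset.range (k + 1)) (t := R)
    (fun i => N.ident (q.getVert (j i)))
    (fun i hi => (hj i (Finset.mem_range.1 hi)).2) (by
      intro i hi i' hi' h
      have hlt : i < k + 1 := Finset.mem_range.1 hi
      have hlt' : i' < k + 1 := Finset.mem_range.1 hi'
      have hj1 := (hj i hlt).1
      have hj2 := (hj i' hlt').1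
      have := hq.getVert_injOn (show j i ≤ q.length by omega) (show j i' ≤ q.length by omega)
        (N.ident_injective h)
      omega)
  rw [Finset.card_range] at h
  omega

end CongestNetwork

/-! ### Evolution of the states during a run -/

namespace CoverFlooding

open CongestNetwork

variable {V : Type*} (N : CongestNetwork V) (k : ℕ)

/-- The items that `v` knows after `t` rounds. -/
noncomputable def known (t : ℕ) (v : V) : Set (List Bool) := (coverFlooding.state N k t v).known

/-- The items that `v` has sent within `t` rounds. -/
noncomputable def sent (t : ℕ) (v : V) : Set (List Bool) := (coverFlooding.state N k t v).sent

theorem state_succ_of_isSome {t : ℕ} {v : V}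
    (h : (coverFlooding.output (coverFlooding.state N k t v)).isSome) :
    coverFlooding.state N k (t + 1) v = coverFlooding.state N k t v := by
  rw [DistributedAlgorithm.state, if_pos h]

theorem state_param_ident (t : ℕ) (v : V) :
    (coverFlooding.state N k t v).param = k ∧ (coverFlooding.state N k t v).ident = N.ident v := by
  induction t with
  | zero => exact ⟨rfl, rfl⟩
  | succ t ih =>
    rw [DistributedAlgorithm.state]
    split_ifs
    · exact ih
    · simp only [coverFlooding] at ih ⊢
      split_ifs <;> exact ih

theorem isSome_output (t : ℕ) (v : V) :
    (coverFlooding.output (coverFlooding.state N k t v)).isSome ↔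
      7 * k ^ 2 ≤ (coverFlooding.state N k t v).time := by
  have h := (state_param_ident N k t v).1
  simp only [coverFlooding] at h ⊢
  rw [h]
  split_ifs with h' <;> simp [h']

theorem state_time (t : ℕ) (ht : t ≤ 7 * k ^ 2) (v : V) :
    (coverFlooding.state N k t v).time = t := by
  induction t with
  | zero => rfl
  | succ t ih =>
    have ih := ih (by omega)
    rw [DistributedAlgorithm.state, if_neg (by
      rw [isSome_output, ih]; omega)]
    simp only [coverFlooding] at ih ⊢
    split_ifs with h
    · exact congrArg (· + 1) (h.symm.trans ih)
    · exact congrArg (· + 1) ih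

theorem state_of_le {t : ℕ} (ht : 7 * k ^ 2 ≤ t) (v : V) :
    coverFlooding.state N k t v = coverFlooding.state N k (7 * k ^ 2) v := by
  induction t, ht using Nat.le_induction with
  | base => rfl
  | succ t ht ih =>
    rw [state_succ_of_isSome, ih]
    rw [isSome_output, ih, state_time N k _ le_rfl]

theorem not_isSome_output {t : ℕ} (ht : t < 7 * k ^ 2) (v : V) :
    ¬ (coverFlooding.output (coverFlooding.state N k t v)).isSome := by
  rw [isSome_output, state_time N k t ht.le]
  omega

theorem message_zero (hk : 0 < 7 * k ^ 2) (v : V) (p : Fin (N.deg v)) :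
    coverFlooding.message (N.deg v) (coverFlooding.state N k 0 v) p =
      if N.deg v ≤ k then pairCode (N.ident v) (N.ident v) else [] := by
  rw [DistributedAlgorithm.message, if_neg (not_isSome_output N k hk v)]
  rfl

theorem message_pos {t : ℕ} (ht0 : t ≠ 0) (ht : t < 7 * k ^ 2) (v : V) (p : Fin (N.deg v)) :
    coverFlooding.message (N.deg v) (coverFlooding.state N k t v) p =
      nextItem (known N k t v) (sent N k t v) := by
  rw [DistributedAlgorithm.message, if_neg (not_isSome_output N k ht v)]
  have h := state_time N k t ht.le v
  exact if_neg (h.trans_ne ht0)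

theorem known_zero (v : V) :
    known N k 0 v = {m | k < N.deg v ∧ m = pairCode (N.ident v) (N.ident v)} := rfl

theorem known_one (hk : 0 < 7 * k ^ 2) (v : V) : known N k 1 v = N.ownItems k v := by
  have h1 : known N k 1 v = known N k 0 v ∪ {m | N.deg v ≤ k ∧ ∃ p y,
      coverFlooding.message (N.deg (N.neighbor v p))
        (coverFlooding.state N k 0 (N.neighbor v p)) (N.backPort v p) = pairCode y y ∧
      m = pairCode (N.ident v) y} := by
    rw [known, DistributedAlgorithm.state, if_neg (not_isSome_output N k hk v)]
    rfl
  rw [h1, known_zero]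
  ext m
  simp only [message_zero N k hk, Set.mem_union, ownItems]
  refine or_congr Iff.rfl (and_congr_right fun _ => ⟨?_, ?_⟩)
  · rintro ⟨p, y, h, rfl⟩
    split_ifs at h with hd
    · obtain ⟨rfl, -⟩ := pairCode_inj h
      exact ⟨_, N.neighbor_adj v p, hd, rfl⟩
    · exact absurd h.symm (pairCode_ne_nil _ _)
  · rintro ⟨w, hw, hd, rfl⟩
    obtain ⟨p, rfl⟩ := N.exists_neighbor hw
    exact ⟨p, _, if_pos hd, rfl⟩

theorem sent_one (hk : 0 < 7 * k ^ 2) (v : V) : sent N k 1 v = ∅ := by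
  rw [sent, DistributedAlgorithm.state, if_neg (not_isSome_output N k hk v)]
  rfl

theorem known_succ {t : ℕ} (ht0 : t ≠ 0) (ht : t < 7 * k ^ 2) (v : V) :
    known N k (t + 1) v = known N k t v ∪
      (Set.range (fun p => nextItem (known N k t (N.neighbor v p)) (sent N k t (N.neighbor v p)))
        \ {[]}) := by
  simp only [← message_pos N k ht0 ht _ (N.backPort v _)]
  have h := state_time N k t ht.le v
  rw [known, DistributedAlgorithm.state, if_neg (not_isSome_output N k ht v)]
  simp only [coverFlooding] at h ⊢
  rw [if_neg (h.trans_ne ht0)]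
  rfl

theorem sent_succ {t : ℕ} (ht0 : t ≠ 0) (ht : t < 7 * k ^ 2) (v : V) :
    sent N k (t + 1) v = sent N k t v ∪
      ({nextItem (known N k t v) (sent N k t v)} \ {[]}) := by
  have h := state_time N k t ht.le v
  rw [sent, DistributedAlgorithm.state, if_neg (not_isSome_output N k ht v)]
  simp only [coverFlooding] at h ⊢
  rw [if_neg (h.trans_ne ht0)]
  rfl

theorem known_subset_items {t : ℕ} (ht : t ≤ 7 * k ^ 2) (v : V) : known N k t v ⊆ N.items k := by
  induction t generalizing v with
  | zero =>
    rw [known_zero]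
    exact fun m hm => N.ownItems_subset_items k v (Or.inl hm)
  | succ t ih =>
    rcases eq_or_ne t 0 with rfl | h0
    · rw [known_one N k (by omega)]
      exact N.ownItems_subset_items k v
    · rw [known_succ N k h0 (by omega)]
      refine Set.union_subset (ih (by omega) v) ?_
      rintro _ ⟨⟨p, rfl⟩, hm⟩
      exact ih (by omega) _ (nextItem_mem hm).1

theorem sent_subset_known {t : ℕ} (ht0 : t ≠ 0) (ht : t ≤ 7 * k ^ 2) (v : V)
    (p : Fin (N.deg v)) : sent N k t (N.neighbor v p) ⊆ known N k t v := by
  induction t, Nat.one_le_iff_ne_zero.2 ht0 using Nat.le_induction with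
  | base => simp [sent_one N k (by omega)]
  | succ t h1 ih =>
    rw [sent_succ N k (by omega) (by omega), known_succ N k (by omega) (by omega)]
    refine Set.union_subset_union (ih (by omega) (by omega)) ?_
    rintro _ ⟨rfl, h⟩
    exact ⟨⟨p, rfl⟩, h⟩

theorem ownItems_subset_known {t : ℕ} (ht0 : t ≠ 0) (ht : t ≤ 7 * k ^ 2) (v : V) :
    N.ownItems k v ⊆ known N k t v := by
  induction t, Nat.one_le_iff_ne_zero.2 ht0 using Nat.le_induction with
  | base => rw [known_one N k (by omega)]
  | succ t h1 ih =>
    rw [known_succ N k (by omega) (by omega)]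
    exact (ih (by omega) (by omega)).trans Set.subset_union_left

theorem sent_subset_known_self {t : ℕ} (ht0 : t ≠ 0) (ht : t ≤ 7 * k ^ 2) (v : V) :
    sent N k t v ⊆ known N k t v := by
  induction t, Nat.one_le_iff_ne_zero.2 ht0 using Nat.le_induction with
  | base => simp [sent_one N k (by omega)]
  | succ t h1 ih =>
    rw [sent_succ N k (by omega) (by omega), known_succ N k (by omega) (by omega)]
    refine Set.union_subset ((ih (by omega) (by omega)).trans Set.subset_union_left) ?_
    rintro _ ⟨rfl, h⟩
    exact Or.inl (nextItem_mem h).1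

/-! ### Pipelining -/

/-- If the bound on the known items holds at all times, then it holds for the sent items one
round later. -/
theorem le_ncard_sent [Finite V] {d : ℕ} {v : V}
    (hK : ∀ t ≠ 0, t ≤ 7 * k ^ 2 →
      t ≤ (known N k t v).ncard + d ∨ N.KnowsBall k d v (known N k t v))
    {t : ℕ} (ht0 : t ≠ 0) (ht : t ≤ 7 * k ^ 2) :
    t ≤ (sent N k t v).ncard + d + 1 ∨ N.KnowsBall k d v (sent N k t v) := by
  induction t, Nat.one_le_iff_ne_zero.2 ht0 using Nat.le_induction with
  | base => left; omega
  | succ t h1 ih =>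
    have hfin : (sent N k (t + 1) v).Finite := (N.finite_items k).subset
      ((sent_subset_known_self N k ht0 ht v).trans (known_subset_items N k ht v))
    have hss := sent_succ N k (t := t) (by omega) (by omega) v
    have hsub : sent N k t v ⊆ sent N k (t + 1) v := hss ▸ Set.subset_union_left
    -- Either a new item is sent, and the count keeps pace with the clock, or everything known at
    -- time `t` has been sent, and the bound for `known` carries over one round late.
    by_cases hne : (known N k t v \ sent N k t v).Nonempty
    · rcases ih (by omega) (by omega) with h | h
      · left
        have hmem := nextItem_mem_of_nonempty hne
        have hnil := N.ne_nil_of_mem_items (known_subset_items N k (by omega) v hmem.1)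
        have hins : insert (nextItem (known N k t v) (sent N k t v)) (sent N k t v) ⊆
            sent N k (t + 1) v :=
          Set.insert_subset (hss ▸ Or.inr ⟨rfl, hnil⟩) hsub
        have := Set.ncard_le_ncard hins hfin
        rw [Set.ncard_insert_of_notMem hmem.2 (hfin.subset hsub)] at this
        omega
      · exact Or.inr (h.mono hsub)
    · have hks : known N k t v ⊆ sent N k (t + 1) v :=
        (Set.sdiff_eq_empty.1 (Set.not_nonempty_iff_eq_empty.1 hne)).trans hsub
      rcases hK t (by omega) (by omega) with h | h
      · left
        have := Set.ncard_le_ncard hks hfin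
        omega
      · exact Or.inr (h.mono hks)

/-- Pipelined flooding: after `t` rounds a vertex knows at least `t - d` items or everything
that originates within distance `d`. -/
theorem le_ncard_known [Finite V] (d : ℕ) (v : V) (t : ℕ) (ht0 : t ≠ 0) (ht : t ≤ 7 * k ^ 2) :
    t ≤ (known N k t v).ncard + d ∨ N.KnowsBall k d v (known N k t v) := by
  induction d generalizing v t with
  | zero =>
    right
    intro u q hq
    obtain rfl := SimpleGraph.Walk.eq_of_length_eq_zero (Nat.le_zero.1 hq)
    exact ownItems_subset_known N k ht0 ht v
  | succ d ih =>
    -- One neighbour that has sent many items suffices for the count; otherwise every neighbour has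
    -- sent its whole ball of radius `d`, and these balls with `v` make up the ball of radius `d +
    -- 1`.
    by_cases h : ∃ p, t ≤ (sent N k t (N.neighbor v p)).ncard + d + 1
    · obtain ⟨p, hp⟩ := h
      have := Set.ncard_le_ncard (sent_subset_known N k ht0 ht v p)
        ((N.finite_items k).subset (known_subset_items N k ht v))
      left
      omega
    · right
      intro u q hq
      cases q with
      | nil => exact ownItems_subset_known N k ht0 ht v
      | cons hadj q =>
        obtain ⟨p, rfl⟩ := N.exists_neighbor hadj
        have hb := (le_ncard_sent N k (ih (N.neighbor v p)) ht0 ht).resolve_left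
          fun hp => h ⟨p, hp⟩
        refine (hb u q ?_).trans (sent_subset_known N k ht0 ht v p)
        simpa using hq

/-- The running time is chosen so that `7 * k ^ 2 - (2 * k + 1)` exceeds `k * (2 * k + 1)` for `k ≥
1`. -/
theorem known_final [Finite V] (v : V) :
    k * (2 * k + 1) < (known N k (7 * k ^ 2) v).ncard ∨
      N.KnowsBall k (2 * k + 1) v (known N k (7 * k ^ 2) v) := by
  rcases Nat.eq_zero_or_pos k with rfl | hk
  -- For `k = 0` no round takes place: the initial loop at a vertex with a neighbour already exceeds
  -- the bound `0`, and a vertex without neighbours is its own ball.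
  · change _ < (known N 0 0 v).ncard ∨ N.KnowsBall 0 1 v (known N 0 0 v)
    rw [known_zero]
    rcases Nat.eq_zero_or_pos (N.deg v) with h | h
    · right
      have hadj : ∀ w, ¬ N.graph.Adj v w := fun w hw =>
        (Fin.cast h (N.exists_neighbor hw).choose).elim0
      intro u q _
      cases q with
      | nil =>
        rintro m (hm | ⟨-, w, hw, -⟩)
        exacts [hm, absurd hw (hadj w)]
      | cons hw _ => exact absurd hw (hadj _)
    · left
      have : {m | 0 < N.deg v ∧ m = pairCode (N.ident v) (N.ident v)} =
          {pairCode (N.ident v) (N.ident v)} := by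
        ext m; simp [h]
      simp [this]
  · refine (le_ncard_known N k (2 * k + 1) v (7 * k ^ 2) (by positivity) le_rfl).imp_left ?_
    intro h
    nlinarith

/-! ### Correctness of the reports -/

theorem output_final (v : V) :
    coverFlooding.output (coverFlooding.state N k (7 * k ^ 2) v) =
      some (coverReport k (N.ident v) (known N k (7 * k ^ 2) v)) := by
  have h1 := state_time N k _ le_rfl v
  obtain ⟨h2, h3⟩ := state_param_ident N k (7 * k ^ 2) v
  rw [known]
  generalize coverFlooding.state N k (7 * k ^ 2) v = s at *
  change (if 7 * s.param ^ 2 ≤ s.time then some (coverReport s.param s.ident s.known) else none) = _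
  rw [h1, h2, if_pos le_rfl, h3]

theorem known_final_eq_items [Finite V] {v : V} {R : Finset ℕ}
    (hc : (known N k (7 * k ^ 2) v).ncard ≤ k * (2 * k + 1)) (hk : R.card ≤ k)
    (hR : Hits R (known N k (7 * k ^ 2) v)) : known N k (7 * k ^ 2) v = N.items k := by
  have hball := (known_final N k v).resolve_left (not_lt.2 hc)
  refine (known_subset_items N k le_rfl v).antisymm (Set.iUnion_subset fun u => ?_)
  obtain ⟨q, hq⟩ := N.exists_walk_length_le hk hR hball u
  exact hball u q hq

theorem isVertexCover_of_hits_items {R : Finset ℕ} (hR : Hits R (N.items k)) :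
    N.graph.IsVertexCover {v | N.ident v ∈ R} := fun _ _ h =>
  N.hits_edge hR h (N.ownItems_subset_items k _) (N.ownItems_subset_items k _)

open Classical in
theorem exists_finset_of_hits_items [Fintype V] {R : Finset ℕ} (hk : R.card ≤ k)
    (hR : Hits R (N.items k)) : ∃ S : Finset V, (∀ v, v ∈ S ↔ N.ident v ∈ R) ∧
      N.graph.IsVertexCover (S : Set V) ∧ S.card ≤ k := by
  refine ⟨Finset.univ.filter fun v => N.ident v ∈ R, by simp, ?_, ?_⟩
  · simpa using isVertexCover_of_hits_items N k hR
  · refine (Finset.card_le_card_of_injOn N.ident ?_ N.ident_injective.injOn).trans hk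
    intro v hv
    simpa using hv

theorem solves [Fintype V] :
    SolvesKMVC N.graph k fun v => coverReport k (N.ident v) (known N k (7 * k ^ 2) v) := by
  refine ⟨?_, fun hno v => ?_⟩
  · rintro ⟨S, hS, hk⟩
    have hcard := N.ncard_items_le hS hk
    have hhits := N.hits_items hS hk
    have hRk : (S.image N.ident).card ≤ k := Finset.card_image_le.trans hk
    have hall : ∀ v, known N k (7 * k ^ 2) v = N.items k := fun v => by
      have hsub := known_subset_items N k le_rfl v
      exact known_final_eq_items N k
        ((Set.ncard_le_ncard hsub (N.finite_items k)).trans hcard) hRk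
        fun x y h => hhits x y (hsub h)
    have hex : (N.items k).ncard ≤ k * (2 * k + 1) ∧
        ∃ R : Finset ℕ, R.card ≤ k ∧ Hits R (N.items k) := ⟨hcard, _, hRk, hhits⟩
    -- The solution chosen in `coverReport` depends only on `k` and the set of known items, so all
    -- vertices use the same one.
    have hrep : ∀ v, coverReport k (N.ident v) (known N k (7 * k ^ 2) v) =
        if N.ident v ∈ hex.2.choose then .inCover else .notInCover := fun v => by
      rw [hall, coverReport, dif_pos hex]
    simp only [hrep]
    refine ⟨fun v => by split_ifs <;> simp, ?_⟩
    obtain ⟨S', h1, h2⟩ :=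
      exists_finset_of_hits_items N k hex.2.choose_spec.1 hex.2.choose_spec.2
    refine ⟨S', fun v => (h1 v).trans ?_, h2⟩
    split_ifs with h <;> simp [h]
  · refine dif_neg fun h => hno ?_
    obtain ⟨hc, R, hk, hR⟩ := h
    rw [known_final_eq_items N k hc hk hR] at hR
    obtain ⟨S, -, hS⟩ := exists_finset_of_hits_items N k hk hR
    exact ⟨S, hS⟩

/-! ### Message length -/

theorem message_eq (t : ℕ) (v : V) (p : Fin (N.deg v)) :
    coverFlooding.message (N.deg v) (coverFlooding.state N k t v) p = [] ∨
      ∃ u w, coverFlooding.message (N.deg v) (coverFlooding.state N k t v) p =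
        pairCode (N.ident u) (N.ident w) := by
  rcases lt_or_ge t (7 * k ^ 2) with ht | ht
  · rcases eq_or_ne t 0 with rfl | h0
    · rw [message_zero N k ht]
      split_ifs
      exacts [Or.inr ⟨v, v, rfl⟩, Or.inl rfl]
    · rw [message_pos N k h0 ht, or_iff_not_imp_left]
      exact fun h => N.exists_eq_of_mem_items (known_subset_items N k ht.le v (nextItem_mem h).1)
  · left
    rw [DistributedAlgorithm.message, if_pos]
    rw [state_of_le N k ht, output_final]
    rfl

theorem messagesBounded [Fintype V] {a : ℕ} (ha : ∀ v, N.ident v < Fintype.card V ^ a) :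
    coverFlooding.MessagesBounded N k ((4 * a + 1) * Nat.log 2 (Fintype.card V)) := by
  intro t v p
  -- A port leads to a second vertex; on a single vertex, where the logarithm vanishes, there are no
  -- messages.
  have hn : 2 ≤ Fintype.card V :=
    Fintype.one_lt_card_iff.2 ⟨v, _, (N.neighbor_adj v p).ne⟩
  rcases message_eq N k t v p with h | ⟨u, w, h⟩ <;> rw [h]
  · simp
  · exact length_pairCode_le hn (ha u) (ha w)

end CoverFlooding

theorem mainTheorem4 :
    ∃ (A : DistributedAlgorithm) (C : ℕ), ∀ a : ℕ, ∃ b : ℕ,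
      ∀ (V : Type*) [Fintype V] (N : CongestNetwork V),
        (∀ v, N.ident v < Fintype.card V ^ a) →
        ∀ k : ℕ,
          A.MessagesBounded N k (b * Nat.log 2 (Fintype.card V)) ∧
          ∃ o : V → CoverAnswer,
            A.TerminatesWithin N k (C * k ^ 2) o ∧ SolvesKMVC N.graph k o :=
  ⟨coverFlooding, 7, fun a => ⟨4 * a + 1, fun _ _ N ha k =>
    ⟨CoverFlooding.messagesBounded N k ha, _,
      fun v => ⟨_, le_rfl, CoverFlooding.output_final N k v⟩, CoverFlooding.solves N k⟩⟩⟩
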